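/- Let $k$ be a field of characteristic different from $2$ and $3$, and let $L = L_{\bar 0}\oplus L_{\bar 1}$ be a finite-dimensional nilpotent Lie superalgebra over $k$ with $\dim L_{\bar 0} = m$ and $\dim L_{\bar 1} = n$, where $n \ge 1$. Suppose that the derived subsuperalgebra $L^2 = [L,L]$ has dimension $m+n-2$. Let $\mathcal M(L)$ be the Schur multiplier of $L$, that is, $\mathcal M(L) = (R\cap F^2)/[R,F]$ for a presentation $L \cong F/R$ with $F$ a free Lie superalgebra on homogeneous generators. Then, for every such presentation, $\mathcal M(L)$ is finite-dimensional, and if $m+n \ge 6$, then $$\dim \mathcal M(L) < m + 2n - 4.$$ Consequently, if $\dim \mathcal M(L) = m+2n-4$, then $m+n \le 5$. -/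

import Mathlib

noncomputable section

/-- A Lie superalgebra over `k` (a field of characteristic different from `2` and `3` in the
application): a `ℤ/2`-graded vector space `L = part 0 ⊕ part 1` with a bilinear bracket of degree
`0` satisfying graded skew-symmetry and the graded Jacobi identity on homogeneous elements. -/
class LieSuperalgebra (k L : Type*) [Field k] [AddCommGroup L] [Module k L] where
  /-- `part 0` is the even part, `part 1` the odd part. -/
  part : ZMod 2 → Submodule k L
  isCompl : IsCompl (part 0) (part 1)
  /-- The (super)bracket `[x, y]`. -/
  bracket : L →ₗ[k] L →ₗ[k] L
  bracket_mem : ∀ {a b : ZMod 2} {x y : L}, x ∈ part a → y ∈ part b →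
    bracket x y ∈ part (a + b)
  skew : ∀ {a b : ZMod 2} {x y : L}, x ∈ part a → y ∈ part b →
    bracket x y = -((-1 : k) ^ (a.val * b.val) • bracket y x)
  jacobi : ∀ {a b : ZMod 2} {x y z : L}, x ∈ part a → y ∈ part b →
    bracket x (bracket y z) =
      bracket (bracket x y) z + (-1 : k) ^ (a.val * b.val) • bracket y (bracket x z)

namespace LieSuperalgebra

section Basic

variable (k L : Type*) [Field k] [AddCommGroup L] [Module k L] [LieSuperalgebra k L]

/-- `[U, V]`: the linear span of all brackets `[u, v]` with `u ∈ U` and `v ∈ V`. -/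
def commutator {k L : Type*} [Field k] [AddCommGroup L] [Module k L] [LieSuperalgebra k L]
    (U V : Submodule k L) : Submodule k L :=
  Submodule.map₂ (bracket (k := k) (L := L)) U V

/-- The derived subsuperalgebra `L² = [L, L]`. -/
def derived : Submodule k L := commutator ⊤ ⊤

/-- The lower central series `C⁰(L) = L`, `Cⁱ⁺¹(L) = [L, Cⁱ(L)]`. -/
def lowerCentral : ℕ → Submodule k L
  | 0 => ⊤
  | i + 1 => commutator ⊤ (lowerCentral i)

/-- `L` is nilpotent if `Cⁱ(L) = 0` for some `i`. -/
def IsNilpotent : Prop := ∃ i : ℕ, lowerCentral k L i = ⊥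

end Basic

/-- Homomorphisms of Lie superalgebras: even linear maps that preserve the bracket. -/
structure Hom (k L M : Type*) [Field k] [AddCommGroup L] [Module k L] [LieSuperalgebra k L]
    [AddCommGroup M] [Module k M] [LieSuperalgebra k M] extends L →ₗ[k] M where
  map_bracket : ∀ x y : L, toLinearMap (bracket (k := k) x y) =
    bracket (k := k) (toLinearMap x) (toLinearMap y)
  map_part : ∀ (a : ZMod 2) (x : L), x ∈ part (k := k) a → toLinearMap x ∈ part (k := k) a

end LieSuperalgebra

namespace FreeLieSuper

variable (k : Type*) [Field k] {X : Type*} (p : X → ZMod 2)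

/-- The parity of a nonassociative word in generators `x` of parity `p x`. -/
def wordParity : FreeMagma X → ZMod 2
  | .of x => p x
  | .mul u v => wordParity u + wordParity v

/-- The homogeneous component of parity `a` of the free nonassociative algebra: the span of the
words of parity `a`. -/
def freePart (a : ZMod 2) : Submodule k (FreeNonUnitalNonAssocAlgebra k X) :=
  MonoidAlgebra.supported k k {w : FreeMagma X | wordParity p w = a}

/-- `Rel k p a x`: `x` is one of the homogeneous elements, of parity `a`, that generate the ideal
of relations. They are the graded skew-symmetry and graded Jacobi relators of homogeneous elements,
and their multiples by homogeneous elements. -/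
inductive Rel : ZMod 2 → FreeNonUnitalNonAssocAlgebra k X → Prop
  | skew {a b : ZMod 2} {x y : FreeNonUnitalNonAssocAlgebra k X}
      (hx : x ∈ freePart k p a) (hy : y ∈ freePart k p b) :
      Rel (a + b) (x * y + (-1 : k) ^ (a.val * b.val) • (y * x))
  | jacobi {a b c : ZMod 2} {x y z : FreeNonUnitalNonAssocAlgebra k X}
      (hx : x ∈ freePart k p a) (hy : y ∈ freePart k p b) (hz : z ∈ freePart k p c) :
      Rel (a + b + c)
        (x * (y * z) - (x * y) * z - (-1 : k) ^ (a.val * b.val) • (y * (x * z)))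
  | mul_left {a b : ZMod 2} {x y : FreeNonUnitalNonAssocAlgebra k X}
      (hx : x ∈ freePart k p a) (hy : Rel b y) : Rel (a + b) (x * y)
  | mul_right {a b : ZMod 2} {x y : FreeNonUnitalNonAssocAlgebra k X}
      (hx : Rel a x) (hy : y ∈ freePart k p b) : Rel (a + b) (x * y)

/-- The ideal of relations of the free Lie superalgebra. -/
def relIdeal : Submodule k (FreeNonUnitalNonAssocAlgebra k X) :=
  Submodule.span k {x | ∃ a, Rel k p a x}

theorem freePart_isCompl : IsCompl (freePart k p 0) (freePart k p 1) := by
  classical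
  constructor
  · rw [Submodule.disjoint_def]
    intro x h0 h1
    rw [freePart, MonoidAlgebra.mem_supported'] at h0 h1
    ext w
    by_cases h : wordParity p w = 0
    · exact h1 w (by simp [h])
    · exact h0 w (by simpa using h)
  · rw [codisjoint_iff, eq_top_iff]
    intro x _
    induction x using MonoidAlgebra.induction_linear with
    | zero => exact Submodule.zero_mem _
    | add x y hx hy => exact Submodule.add_mem _ (hx trivial) (hy trivial)
    | single w r =>
      have key : ∀ a, wordParity p w = a →
          (MonoidAlgebra.single w r : FreeNonUnitalNonAssocAlgebra k X) ∈ freePart k p a := by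
        intro a ha
        rw [freePart, MonoidAlgebra.mem_supported']
        intro v hv
        have : w ≠ v := by rintro rfl; exact hv ha
        simp [this]
      rcases (by decide : ∀ a : ZMod 2, a = 0 ∨ a = 1) (wordParity p w) with h | h
      · exact Submodule.mem_sup_left (key 0 h)
      · exact Submodule.mem_sup_right (key 1 h)

theorem mul_mem_freePart {a b : ZMod 2} {x y : FreeNonUnitalNonAssocAlgebra k X}
    (hx : x ∈ freePart k p a) (hy : y ∈ freePart k p b) : x * y ∈ freePart k p (a + b) := by
  rw [freePart, MonoidAlgebra.supported_eq_span_single] at *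
  induction hx using Submodule.span_induction with
  | zero => simp
  | add x₁ x₂ _ _ h₁ h₂ => rw [add_mul]; exact Submodule.add_mem _ h₁ h₂
  | smul r x _ h => rw [smul_mul_assoc]; exact Submodule.smul_mem _ _ h
  | mem x hx =>
    induction hy using Submodule.span_induction with
    | zero => simp
    | add x₁ x₂ _ _ h₁ h₂ => rw [mul_add]; exact Submodule.add_mem _ h₁ h₂
    | smul r x _ h => rw [mul_smul_comm]; exact Submodule.smul_mem _ _ h
    | mem y hy =>
      obtain ⟨u, rfl, rfl⟩ := hx
      obtain ⟨v, rfl, rfl⟩ := hy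
      refine Submodule.subset_span ⟨u * v, rfl, ?_⟩
      simp [MonoidAlgebra.single_mul_single]

theorem Rel.mem_freePart {a : ZMod 2} {x : FreeNonUnitalNonAssocAlgebra k X}
    (h : Rel k p a x) : x ∈ freePart k p a := by
  induction h with
  | @skew a b x y hx hy =>
    refine Submodule.add_mem _ (mul_mem_freePart k p hx hy) (Submodule.smul_mem _ _ ?_)
    rw [add_comm]
    exact mul_mem_freePart k p hy hx
  | @jacobi a b c x y z hx hy hz =>
    refine Submodule.sub_mem _ (Submodule.sub_mem _ ?_ ?_) (Submodule.smul_mem _ _ ?_)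
    · rw [add_assoc]
      exact mul_mem_freePart k p hx (mul_mem_freePart k p hy hz)
    · exact mul_mem_freePart k p (mul_mem_freePart k p hx hy) hz
    · rw [add_comm a b, add_assoc]
      exact mul_mem_freePart k p hy (mul_mem_freePart k p hx hz)
  | mul_left hx _ ih => exact mul_mem_freePart k p hx ih
  | mul_right _ hy ih => exact mul_mem_freePart k p ih hy

theorem exists_add (x : FreeNonUnitalNonAssocAlgebra k X) :
    ∃ x₀ ∈ freePart k p 0, ∃ x₁ ∈ freePart k p 1, x₀ + x₁ = x :=
  Submodule.mem_sup.1 ((freePart_isCompl k p).sup_eq_top ▸ Submodule.mem_top)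

theorem mul_mem_relIdeal_left (x : FreeNonUnitalNonAssocAlgebra k X)
    {y : FreeNonUnitalNonAssocAlgebra k X} (hy : y ∈ relIdeal k p) : x * y ∈ relIdeal k p := by
  induction hy using Submodule.span_induction with
  | zero => simp
  | add y₁ y₂ _ _ h₁ h₂ => rw [mul_add]; exact Submodule.add_mem _ h₁ h₂
  | smul r y _ h => rw [mul_smul_comm]; exact Submodule.smul_mem _ _ h
  | mem y hy =>
    obtain ⟨b, hb⟩ := hy
    obtain ⟨x₀, h₀, x₁, h₁, rfl⟩ := exists_add k p x
    rw [add_mul]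
    exact Submodule.add_mem _ (Submodule.subset_span ⟨_, .mul_left h₀ hb⟩)
      (Submodule.subset_span ⟨_, .mul_left h₁ hb⟩)

theorem mul_mem_relIdeal_right {x : FreeNonUnitalNonAssocAlgebra k X} (hx : x ∈ relIdeal k p)
    (y : FreeNonUnitalNonAssocAlgebra k X) : x * y ∈ relIdeal k p := by
  induction hx using Submodule.span_induction with
  | zero => simp
  | add y₁ y₂ _ _ h₁ h₂ => rw [add_mul]; exact Submodule.add_mem _ h₁ h₂
  | smul r y _ h => rw [smul_mul_assoc]; exact Submodule.smul_mem _ _ h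
  | mem x hx =>
    obtain ⟨b, hb⟩ := hx
    obtain ⟨y₀, h₀, y₁, h₁, rfl⟩ := exists_add k p y
    rw [mul_add]
    exact Submodule.add_mem _ (Submodule.subset_span ⟨_, .mul_right hb h₀⟩)
      (Submodule.subset_span ⟨_, .mul_right hb h₁⟩)

theorem relIdeal_homogeneous {x : FreeNonUnitalNonAssocAlgebra k X} (hx : x ∈ relIdeal k p) :
    ∃ x₀ ∈ relIdeal k p ⊓ freePart k p 0, ∃ x₁ ∈ relIdeal k p ⊓ freePart k p 1, x₀ + x₁ = x := by
  rw [← Submodule.mem_sup]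
  revert x
  change relIdeal k p ≤ _
  conv_lhs => rw [relIdeal]
  refine Submodule.span_le.2 ?_
  rintro x ⟨a, ha⟩
  have hx : x ∈ relIdeal k p := Submodule.subset_span ⟨a, ha⟩
  rcases (by decide : ∀ a : ZMod 2, a = 0 ∨ a = 1) a with rfl | rfl
  · exact Submodule.mem_sup_left ⟨hx, ha.mem_freePart⟩
  · exact Submodule.mem_sup_right ⟨hx, ha.mem_freePart⟩

end FreeLieSuper

/-- The free Lie superalgebra over `k` on the generators `x : X` of parity `p x`: the quotient of
the free nonassociative algebra on `X`, graded by the parity of words, by the ideal generated by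
the graded skew-symmetry and graded Jacobi relators. -/
def FreeLieSuperalgebra (k : Type*) [Field k] {X : Type*} (p : X → ZMod 2) : Type _ :=
  FreeNonUnitalNonAssocAlgebra k X ⧸ FreeLieSuper.relIdeal k p

namespace FreeLieSuperalgebra

open FreeLieSuper

variable (k : Type*) [Field k] {X : Type*} (p : X → ZMod 2)

instance : AddCommGroup (FreeLieSuperalgebra k p) :=
  inferInstanceAs (AddCommGroup (FreeNonUnitalNonAssocAlgebra k X ⧸ relIdeal k p))

instance : Module k (FreeLieSuperalgebra k p) :=
  inferInstanceAs (Module k (FreeNonUnitalNonAssocAlgebra k X ⧸ relIdeal k p))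

/-- The quotient map from the free nonassociative algebra. -/
def mk : FreeNonUnitalNonAssocAlgebra k X →ₗ[k] FreeLieSuperalgebra k p :=
  (relIdeal k p).mkQ

/-- The generator of the free Lie superalgebra attached to `x : X`. -/
def of (x : X) : FreeLieSuperalgebra k p := mk k p (FreeNonUnitalNonAssocAlgebra.of k x)

theorem mk_surjective : Function.Surjective (mk k p) := Submodule.mkQ_surjective _

theorem mk_eq_zero {x : FreeNonUnitalNonAssocAlgebra k X} : mk k p x = 0 ↔ x ∈ relIdeal k p :=
  Submodule.Quotient.mk_eq_zero _

/-- The bracket: the product of the free nonassociative algebra, on classes. -/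
def bracketAux :
    FreeLieSuperalgebra k p →ₗ[k] FreeLieSuperalgebra k p →ₗ[k] FreeLieSuperalgebra k p :=
  (relIdeal k p).liftQ
    (LinearMap.flip ((relIdeal k p).liftQ
      (LinearMap.flip ((LinearMap.mul k (FreeNonUnitalNonAssocAlgebra k X)).compr₂ (mk k p)))
      (fun y hy => LinearMap.ext fun x =>
        (mk_eq_zero k p).2 (mul_mem_relIdeal_left k p x hy))))
    (fun x hx => by
      rw [LinearMap.mem_ker]
      refine LinearMap.ext fun y => ?_
      obtain ⟨y, rfl⟩ := mk_surjective k p y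
      exact (mk_eq_zero k p).2 (mul_mem_relIdeal_right k p hx y))

theorem bracketAux_mk (x y : FreeNonUnitalNonAssocAlgebra k X) :
    bracketAux k p (mk k p x) (mk k p y) = mk k p (x * y) := rfl

instance : LieSuperalgebra k (FreeLieSuperalgebra k p) where
  part a := (freePart k p a).map (mk k p)
  isCompl := by
    constructor
    · rw [Submodule.disjoint_def]
      rintro _ ⟨x, hx, rfl⟩ ⟨y, hy, hxy⟩
      have h : x - y ∈ relIdeal k p := by
        rw [← mk_eq_zero, map_sub, hxy, sub_self]
      obtain ⟨u, ⟨hu, hu'⟩, v, ⟨hv, hv'⟩, huv⟩ := relIdeal_homogeneous k p h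
      have h1 : x - u = y + v := by
        rw [sub_eq_iff_eq_add, add_assoc, add_comm v u, huv]; abel
      have h2 : x - u = 0 :=
        Submodule.disjoint_def.1 (freePart_isCompl k p).disjoint _
          (Submodule.sub_mem _ hx hu') (h1 ▸ Submodule.add_mem _ hy hv')
      rw [sub_eq_zero] at h2
      exact (mk_eq_zero k p).2 (h2 ▸ hu)
    · rw [codisjoint_iff, ← Submodule.map_sup, (freePart_isCompl k p).sup_eq_top,
        Submodule.map_top, LinearMap.range_eq_top]
      exact mk_surjective k p
  bracket := bracketAux k p
  bracket_mem := by
    rintro a b _ _ ⟨x, hx, rfl⟩ ⟨y, hy, rfl⟩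
    exact ⟨x * y, mul_mem_freePart k p hx hy, rfl⟩
  skew := by
    rintro a b _ _ ⟨x, hx, rfl⟩ ⟨y, hy, rfl⟩
    rw [bracketAux_mk, bracketAux_mk, eq_neg_iff_add_eq_zero, ← map_smul, ← map_add, mk_eq_zero]
    exact Submodule.subset_span ⟨_, .skew hx hy⟩
  jacobi := by
    rintro a b _ _ z ⟨x, hx, rfl⟩ ⟨y, hy, rfl⟩
    obtain ⟨z, rfl⟩ := mk_surjective k p z
    simp only [bracketAux_mk]
    rw [← map_smul, ← map_add, ← sub_eq_zero, ← map_sub, mk_eq_zero, ← sub_sub]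
    obtain ⟨z₀, h₀, z₁, h₁, rfl⟩ := exists_add k p z
    have e := Submodule.add_mem (relIdeal k p)
      (Submodule.subset_span ⟨_, .jacobi hx hy h₀⟩)
      (Submodule.subset_span ⟨_, .jacobi hx hy h₁⟩)
    convert e using 1
    simp only [mul_add, smul_add]
    abel

end FreeLieSuperalgebra

/-- A free presentation `0 → R → F → L → 0` of a Lie superalgebra `L`: a free Lie superalgebra `F`
on generators `x : X` of parity `parity x`, and a surjective homomorphism `F → L`. -/
structure FreePresentation (k L : Type*) [Field k] [AddCommGroup L] [Module k L]
    [LieSuperalgebra k L] (X : Type*) where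
  parity : X → ZMod 2
  toHom : LieSuperalgebra.Hom k (FreeLieSuperalgebra k parity) L
  surjective : Function.Surjective toHom.toLinearMap

namespace FreePresentation

open LieSuperalgebra

variable {k L : Type*} [Field k] [AddCommGroup L] [Module k L] [LieSuperalgebra k L] {X : Type*}
  (P : FreePresentation k L X)

/-- The ideal of relations `R`, so that `L ≅ F / R`. -/
def relations : Submodule k (FreeLieSuperalgebra k P.parity) :=
  LinearMap.ker P.toHom.toLinearMap

/-- The Schur multiplier `(R ∩ F²) / [R, F]`, computed from the free presentation `L ≅ F / R`. -/
abbrev SchurMultiplier : Type _ :=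
  ↥(P.relations ⊓ derived k (FreeLieSuperalgebra k P.parity)) ⧸
    (commutator P.relations ⊤).submoduleOf
      (P.relations ⊓ derived k (FreeLieSuperalgebra k P.parity))

end FreePresentation

end

noncomputable section

namespace LieSuperalgebra

variable {k L E : Type*} [Field k] [AddCommGroup L] [Module k L] [LieSuperalgebra k L]
  [AddCommGroup E] [Module k E]

/-! Write `d = dim L²`. The extension `F/[R,F]` of `L = F/R` is central, so its bracket descends to
a bilinear map `β` on `L` that satisfies graded skew-symmetry and Jacobi
(`FreePresentation.exists_cocycle`). The values of `β` span the image of `F²`, in which the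
multiplier is the kernel of the projection onto `L²`. Hence `dim M(L) + d ≤ dim span β`, and it
suffices to show `dim span β ≤ 2d + n - 3`.

As `L/L²` has dimension 2, two homogeneous elements `x`, `y` generate `L` modulo `L²`. Nilpotency
and Jacobi reduce `span β` to `β x x`, `β x y`, `β y y` together with `β x L² + β y L²`
(`IsCocycle.map₂_le`). Each independent syzygy `β x s + β y t = 0` with `s`, `t` in `L²` lowers the
bound `3 + 2d` by one (`IsCocycle.finrank_map₂_add_le`).

If `x` and `y` are both odd, Jacobi on the generators yields three syzygies, and `n ≥ 3`. If `x` is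
even and `y` odd, then `β x x = 0`, and when the odd part of `L²` has dimension `o = n - 1`, at
least `4 - o` syzygies exist. In both cases `d ≥ 4` excludes the degenerate configurations, where a
few brackets already span a subspace stable under `x` and `y`. Two even generators would make `L`
even, against `n ≥ 1`. -/

/-- A bilinear map on a Lie superalgebra with values in a vector space that satisfies the graded
skew-symmetry and Jacobi identities, such as the bracket of a central extension. -/
structure IsCocycle (β : L →ₗ[k] L →ₗ[k] E) : Prop where
  skew : ∀ {a b : ZMod 2} {x y : L}, x ∈ part (k := k) a → y ∈ part (k := k) b →
    β x y = -((-1 : k) ^ (a.val * b.val) • β y x)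
  jacobi : ∀ {a b : ZMod 2} {x y z : L}, x ∈ part (k := k) a → y ∈ part (k := k) b →
    β x (bracket (k := k) y z) =
      β (bracket (k := k) x y) z + (-1 : k) ^ (a.val * b.val) • β y (bracket (k := k) x z)

theorem isCocycle_bracket : IsCocycle (bracket (k := k) (L := L)) := ⟨skew, jacobi⟩

theorem zmod_two_cases (a : ZMod 2) : a = 0 ∨ a = 1 := by
  revert a; decide

theorem exists_part_add (x : L) :
    ∃ x₀ ∈ part (k := k) (L := L) 0, ∃ x₁ ∈ part (k := k) (L := L) 1, x₀ + x₁ = x :=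
  Submodule.mem_sup.1 ((isCompl (k := k) (L := L)).sup_eq_top ▸ Submodule.mem_top)

theorem eq_zero_of_mem_part {x : L} (h0 : x ∈ part (k := k) 0) (h1 : x ∈ part (k := k) 1) :
    x = 0 :=
  Submodule.disjoint_def.1 (isCompl (k := k) (L := L)).disjoint x h0 h1

/-! ### Cocycle identities for even and odd arguments -/

namespace IsCocycle

variable {β : L →ₗ[k] L →ₗ[k] E} (hβ : IsCocycle β)
include hβ

theorem skew_even {x : L} (y : L) (hx : x ∈ part (k := k) 0) : β x y = -β y x := by
  obtain ⟨y₀, h₀, y₁, h₁, rfl⟩ := exists_part_add (k := k) y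
  have e₀ := hβ.skew hx h₀
  have e₁ := hβ.skew hx h₁
  simp only [ZMod.val_zero, zero_mul, pow_zero, one_smul] at e₀ e₁
  simp only [map_add, LinearMap.add_apply, e₀, e₁]
  abel

theorem skew_odd {x y : L} (hx : x ∈ part (k := k) 1) (hy : y ∈ part (k := k) 1) :
    β x y = β y x := by
  have e := hβ.skew hx hy
  simpa [ZMod.val_one] using e

theorem jacobi_even {x : L} (y z : L) (hx : x ∈ part (k := k) 0) :
    β x (bracket (k := k) y z) = β (bracket (k := k) x y) z + β y (bracket (k := k) x z) := by
  obtain ⟨y₀, h₀, y₁, h₁, rfl⟩ := exists_part_add (k := k) y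
  have e₀ := hβ.jacobi (z := z) hx h₀
  have e₁ := hβ.jacobi (z := z) hx h₁
  simp only [ZMod.val_zero, zero_mul, pow_zero, one_smul] at e₀ e₁
  simp only [map_add, LinearMap.add_apply, e₀, e₁]
  abel

theorem jacobi_odd {x y : L} (z : L) (hx : x ∈ part (k := k) 1) (hy : y ∈ part (k := k) 1) :
    β x (bracket (k := k) y z) = β (bracket (k := k) x y) z - β y (bracket (k := k) x z) := by
  have e := hβ.jacobi (z := z) hx hy
  simpa [ZMod.val_one, sub_eq_add_neg] using e

theorem self_even (h2 : (2 : k) ≠ 0) {x : L} (hx : x ∈ part (k := k) 0) : β x x = 0 := by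
  have e := hβ.skew_even x hx
  have : (2 : k) • β x x = 0 := by rw [two_smul]; nth_rw 1 [e]; simp
  exact (smul_eq_zero.1 this).resolve_left h2

end IsCocycle

/-! ### Parities of brackets and the lower central series -/

theorem bracket_even_odd {x y : L} (hx : x ∈ part (k := k) 0) (hy : y ∈ part (k := k) 1) :
    bracket (k := k) x y ∈ part (k := k) 1 := by
  simpa using bracket_mem hx hy

theorem bracket_odd_even {x y : L} (hx : x ∈ part (k := k) 1) (hy : y ∈ part (k := k) 0) :
    bracket (k := k) x y ∈ part (k := k) 1 := by
  simpa using bracket_mem hx hy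

theorem bracket_odd_odd {x y : L} (hx : x ∈ part (k := k) 1) (hy : y ∈ part (k := k) 1) :
    bracket (k := k) x y ∈ part (k := k) 0 := bracket_mem hx hy

theorem bracket_even_even {x y : L} (hx : x ∈ part (k := k) 0) (hy : y ∈ part (k := k) 0) :
    bracket (k := k) x y ∈ part (k := k) 0 := bracket_mem hx hy

theorem bracket_mem_derived (x y : L) : bracket (k := k) x y ∈ derived k L :=
  Submodule.apply_mem_map₂ _ trivial trivial

theorem bracket_mem_lowerCentral_succ (x : L) {y : L} {i : ℕ} (hy : y ∈ lowerCentral k L i) :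
    bracket (k := k) x y ∈ lowerCentral k L (i + 1) :=
  Submodule.apply_mem_map₂ _ trivial hy

theorem lowerCentral_succ_le (i : ℕ) : lowerCentral k L (i + 1) ≤ lowerCentral k L i := by
  induction i with
  | zero => exact le_top
  | succ i ih => exact Submodule.map₂_le_map₂_right ih

theorem lowerCentral_antitone : Antitone (lowerCentral k L) :=
  antitone_nat_of_succ_le lowerCentral_succ_le

/-- The derived subsuperalgebra is spanned by the brackets of homogeneous elements. -/
theorem derived_le_of_homogeneous {S : Submodule k L}
    (h : ∀ (a b : ZMod 2) (x y : L), x ∈ part (k := k) a → y ∈ part (k := k) b →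
      bracket (k := k) x y ∈ S) : derived k L ≤ S := by
  refine Submodule.map₂_le.2 fun x _ y _ => ?_
  obtain ⟨x₀, hx₀, x₁, hx₁, rfl⟩ := exists_part_add (k := k) x
  obtain ⟨y₀, hy₀, y₁, hy₁, rfl⟩ := exists_part_add (k := k) y
  simp only [map_add, LinearMap.add_apply]
  exact S.add_mem (S.add_mem (h _ _ _ _ hx₀ hy₀) (h _ _ _ _ hx₁ hy₀))
    (S.add_mem (h _ _ _ _ hx₀ hy₁) (h _ _ _ _ hx₁ hy₁))

theorem derived_homogeneous :
    derived k L ≤ (derived k L ⊓ part (k := k) 0) ⊔ (derived k L ⊓ part (k := k) 1) := by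
  refine derived_le_of_homogeneous fun a b x y hx hy => ?_
  have h := bracket_mem hx hy
  rcases zmod_two_cases (a + b) with e | e <;> rw [e] at h
  · exact Submodule.mem_sup_left ⟨bracket_mem_derived x y, h⟩
  · exact Submodule.mem_sup_right ⟨bracket_mem_derived x y, h⟩

/-! ### Nilpotency and generation by two elements -/

/-- A subspace contained in its bracket with a nilpotent Lie superalgebra is zero. -/
theorem eq_bot_of_le_commutator (hnil : IsNilpotent k L) {U : Submodule k L}
    (h : U ≤ commutator ⊤ U) : U = ⊥ := by
  obtain ⟨i, hi⟩ := hnil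
  have key : ∀ j, U ≤ lowerCentral k L j := fun j => by
    induction j with
    | zero => exact le_top
    | succ j ih => exact h.trans (Submodule.map₂_le_map₂_right ih)
  exact eq_bot_iff.2 (hi ▸ key i)

/-- The map `[t, ·]` has no nonzero eigenvalue: otherwise the line through `b` would lie in its own
bracket with `L`. -/
theorem bracket_eq_zero_of_mem_span (hnil : IsNilpotent k L) {t b : L}
    (h : bracket (k := k) t b ∈ Submodule.span k {b}) : bracket (k := k) t b = 0 := by
  obtain ⟨r, hr⟩ := Submodule.mem_span_singleton.1 h
  by_cases h0 : r = 0
  · simp [← hr, h0]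
  have : Submodule.span k {b} = ⊥ := by
    refine eq_bot_of_le_commutator hnil ?_
    rw [Submodule.span_singleton_le_iff_mem]
    have : b = bracket (k := k) (r⁻¹ • t) b := by
      simp [← hr, smul_smul, inv_mul_cancel₀ h0]
    rw [this]
    exact Submodule.apply_mem_map₂ _ trivial (by
      rw [← this]; exact Submodule.mem_span_singleton_self b)
  rw [Submodule.span_singleton_eq_bot] at this
  simp [this]

/-- In a nilpotent Lie superalgebra generated by `x` and `y` modulo the derived subsuperalgebra,
the values of a cocycle on `L × L²` are values on `{x, y} × L²`. -/
theorem IsCocycle.apply_mem_of_mem_derived {β : L →ₗ[k] L →ₗ[k] E} (hβ : IsCocycle β)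
    (hnil : IsNilpotent k L) {x y : L} (hxy : Submodule.span k {x, y} ⊔ derived k L = ⊤)
    (a : L) {s : L} (hs : s ∈ derived k L) :
    β a s ∈ (derived k L).map (β x) ⊔ (derived k L).map (β y) := by
  set W := (derived k L).map (β x) ⊔ (derived k L).map (β y)
  obtain ⟨N, hN⟩ := hnil
  -- Fix `s`. By Jacobi, `β [p,q] s` is a combination of `β p [q,s]` and `β q [p,s]`, whose second
  -- arguments lie one step deeper. So the first argument may be reduced modulo `L²` to `x` or `y`.
  have step : ∀ j, (∀ a : L, ∀ s ∈ lowerCentral k L (j + 2), β a s ∈ W) →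
      ∀ a : L, ∀ s ∈ lowerCentral k L (j + 1), β a s ∈ W := by
    intro j ih a s hs
    have hs' : s ∈ derived k L := lowerCentral_antitone (by omega : 1 ≤ j + 1) hs
    have hder : derived k L ≤ W.comap (β.flip s) := by
      refine derived_le_of_homogeneous fun c d p q hp hq => ?_
      have e := hβ.jacobi (z := s) hp hq
      rw [Submodule.mem_comap, LinearMap.flip_apply, eq_sub_of_add_eq e.symm]
      exact W.sub_mem (ih _ _ (bracket_mem_lowerCentral_succ q hs))
        (W.smul_mem _ (ih _ _ (bracket_mem_lowerCentral_succ p hs)))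
    have htop : ⊤ ≤ W.comap (β.flip s) := by
      rw [← hxy, sup_le_iff, Submodule.span_le]
      refine ⟨?_, hder⟩
      rintro _ (rfl | rfl)
      · exact Submodule.mem_sup_left ⟨s, hs', rfl⟩
      · exact Submodule.mem_sup_right ⟨s, hs', rfl⟩
    exact htop (Submodule.mem_top (x := a))
  -- Downward induction along the lower central series, started where it vanishes; `i` bounds the
  -- number of steps left.
  have key : ∀ i j, N ≤ i + j → ∀ a : L, ∀ s ∈ lowerCentral k L (j + 1), β a s ∈ W := by
    intro i
    induction i with
    | zero =>
      intro j hj a s hs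
      have : s ∈ lowerCentral k L N := lowerCentral_antitone (by omega) hs
      rw [hN, Submodule.mem_bot] at this
      simp [this]
    | succ i ih =>
      intro j hj
      exact step j (ih (j + 1) (by omega))
  exact key N 0 (by omega) a s hs

/-- The image of a cocycle is spanned by its values on pairs of generators and on
`{x, y} × L²`. -/
theorem IsCocycle.map₂_le {β : L →ₗ[k] L →ₗ[k] E} (hβ : IsCocycle β)
    (hnil : IsNilpotent k L) {x y : L} {a b : ZMod 2} (hx : x ∈ part (k := k) a)
    (hy : y ∈ part (k := k) b) (hxy : Submodule.span k {x, y} ⊔ derived k L = ⊤) :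
    Submodule.map₂ β ⊤ ⊤ ≤ Submodule.span k {β x x, β x y, β y y} ⊔
      ((derived k L).map (β x) ⊔ (derived k L).map (β y)) := by
  set W := (derived k L).map (β x) ⊔ (derived k L).map (β y)
  set G := Submodule.span k {β x x, β x y, β y y}
  have hW : ∀ p, ∀ s ∈ derived k L, β p s ∈ G ⊔ W := fun p s hs =>
    Submodule.mem_sup_right (hβ.apply_mem_of_mem_derived hnil hxy p hs)
  have hG : ∀ t ∈ ({β x x, β x y, β y y} : Set E), t ∈ G ⊔ W := fun t ht =>
    Submodule.mem_sup_left (Submodule.subset_span ht)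
  have hyx : β y x ∈ G ⊔ W := by
    rw [hβ.skew hy hx]
    exact Submodule.neg_mem _ (Submodule.smul_mem _ _ (hG _ (by simp)))
  have hgen : ∀ t ∈ ({x, y} : Set L), ∀ u, β t u ∈ G ⊔ W := by
    intro t ht u
    have : ⊤ ≤ (G ⊔ W).comap (β t) := by
      rw [← hxy, sup_le_iff, Submodule.span_le]
      refine ⟨?_, hW t⟩
      rcases ht with rfl | rfl <;> rintro _ (rfl | rfl)
      · exact hG _ (by simp)
      · exact hG _ (by simp)
      · exact hyx
      · exact hG _ (by simp)
    exact this (Submodule.mem_top (x := u))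
  have hsgen : ∀ t ∈ ({x, y} : Set L), ∀ u, β u t ∈ G ⊔ W := by
    intro t ht u
    obtain ⟨u₀, h₀, u₁, h₁, rfl⟩ := exists_part_add (k := k) u
    obtain ⟨c, hc⟩ : ∃ c, t ∈ part (k := k) c := by
      rcases ht with rfl | rfl
      exacts [⟨_, hx⟩, ⟨_, hy⟩]
    rw [map_add, LinearMap.add_apply, hβ.skew h₀ hc, hβ.skew h₁ hc]
    exact Submodule.add_mem _ (Submodule.neg_mem _ (Submodule.smul_mem _ _ (hgen t ht _)))
      (Submodule.neg_mem _ (Submodule.smul_mem _ _ (hgen t ht _)))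
  refine Submodule.map₂_le.2 fun p _ q _ => ?_
  have : ⊤ ≤ (G ⊔ W).comap (β p) := by
    rw [← hxy, sup_le_iff, Submodule.span_le]
    exact ⟨fun t ht => hsgen t ht p, hW p⟩
  exact this (Submodule.mem_top (x := q))

/-- A subspace that contains the brackets of the generators `x`, `y` and is stable under their
adjoint maps contains the derived subsuperalgebra. -/
theorem derived_le_of_stable (hnil : IsNilpotent k L) {x y : L} {a b : ZMod 2}
    (hx : x ∈ part (k := k) a) (hy : y ∈ part (k := k) b)
    (hxy : Submodule.span k {x, y} ⊔ derived k L = ⊤) {S : Submodule k L}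
    (hxx : bracket (k := k) x x ∈ S) (hxy' : bracket (k := k) x y ∈ S)
    (hyy : bracket (k := k) y y ∈ S) (hSx : S ≤ S.comap (bracket (k := k) x))
    (hSy : S ≤ S.comap (bracket (k := k) y)) : derived k L ≤ S := by
  -- The bracket is itself a cocycle, so `L²` is spanned by brackets of generators and `[x, L²] +
  -- [y, L²]`. Substituting the inclusion for `j` into the latter pushes the error term one step
  -- deeper.
  have key : ∀ j, derived k L ≤ S ⊔ lowerCentral k L j := fun j => by
    induction j with
    | zero => exact le_sup_of_le_right le_top
    | succ j ih =>
      have h1 := (isCocycle_bracket (k := k) (L := L)).map₂_le hnil hx hy hxy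
      refine h1.trans (sup_le ?_ (sup_le ?_ ?_))
      · rw [Submodule.span_le]
        rintro _ (rfl | rfl | rfl)
        exacts [Submodule.mem_sup_left hxx, Submodule.mem_sup_left hxy',
          Submodule.mem_sup_left hyy]
      all_goals
        refine (Submodule.map_mono ih).trans ?_
        rw [Submodule.map_sup]
        refine sup_le_sup (Submodule.map_le_iff_le_comap.2 ‹_›) ?_
        rintro _ ⟨s, hs, rfl⟩
        exact bracket_mem_lowerCentral_succ _ hs
  obtain ⟨i, hi⟩ := hnil
  simpa [hi] using key i

/-! ### Counting syzygies -/

open Module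

/-- Independent syzygies between `β x` and `β y` on `L²` lower the dimension of the image of the
cocycle `β`. -/
theorem IsCocycle.finrank_map₂_add_le [FiniteDimensional k L] {β : L →ₗ[k] L →ₗ[k] E}
    (hβ : IsCocycle β) (hnil : IsNilpotent k L) {x y : L} {a b : ZMod 2}
    (hx : x ∈ part (k := k) a) (hy : y ∈ part (k := k) b)
    (hxy : Submodule.span k {x, y} ⊔ derived k L = ⊤) {r : ℕ} {v : Fin r → L × L}
    (hv : LinearIndependent k v)
    (hmem : ∀ i, v i ∈ (derived k L).prod (derived k L))
    (hker : ∀ i, β x (v i).1 + β y (v i).2 = 0) :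
    finrank k (Submodule.map₂ β ⊤ ⊤) + r ≤
      finrank k (Submodule.span k {β x x, β x y, β y y}) + 2 * finrank k (derived k L) := by
  set D := derived k L
  -- Syzygies are the kernel of `(s, t) ↦ β x s + β y t` on `L² × L²`, so rank-nullity bounds its
  -- image by `2d - r`.
  set f := (β x ∘ₗ D.subtype).coprod (β y ∘ₗ D.subtype) with hf
  have hsum := f.finrank_range_add_finrank_ker
  have hrange : LinearMap.range f = D.map (β x) ⊔ D.map (β y) := by
    rw [hf, LinearMap.range_coprod, LinearMap.range_comp, LinearMap.range_comp,
      Submodule.range_subtype]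
  rw [finrank_prod] at hsum
  have hr : r ≤ finrank k (LinearMap.ker f) := by
    let w : Fin r → LinearMap.ker f := fun i => ⟨(⟨_, (hmem i).1⟩, ⟨_, (hmem i).2⟩), hker i⟩
    have hw : LinearIndependent k w :=
      LinearIndependent.of_comp (D.subtype.prodMap D.subtype ∘ₗ (LinearMap.ker f).subtype) hv
    simpa using hw.fintype_card_le_finrank
  have : FiniteDimensional k (Submodule.span k {β x x, β x y, β y y}) :=
    FiniteDimensional.span_of_finite k (Set.toFinite _)
  have h1 := Submodule.finrank_mono (hβ.map₂_le hnil hx hy hxy)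
  have h2 := Submodule.finrank_add_le_finrank_add_finrank
    (Submodule.span k {β x x, β x y, β y y}) (D.map (β x) ⊔ D.map (β y))
  rw [← hrange] at h1 h2
  omega

theorem finrank_span_triple_le (u v w : E) : finrank k (Submodule.span k {u, v, w}) ≤ 3 := by
  classical
  have := finrank_span_finset_le_card (R := k) ({u, v, w} : Finset E)
  have h := Finset.card_le_three (a := u) (b := v) (c := w)
  simp only [Finset.coe_insert, Finset.coe_singleton] at this
  exact this.trans h

theorem finrank_span_pair_le (u v : E) : finrank k (Submodule.span k {u, v}) ≤ 2 := by
  classical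
  have := finrank_span_finset_le_card (R := k) ({u, v} : Finset E)
  have h := Finset.card_le_two (a := u) (b := v)
  simp only [Finset.coe_insert, Finset.coe_singleton] at this
  exact this.trans h

/-! ### Two odd generators -/

section OddOdd

variable {β : L →ₗ[k] L →ₗ[k] E} (hβ : IsCocycle β) {x y : L}
include hβ

/-- Jacobi for `x, x, x` together with skew-symmetry says that three times this value is zero. -/
theorem IsCocycle.odd_cube (h3 : (3 : k) ≠ 0) (hx : x ∈ part (k := k) 1) :
    β x (bracket (k := k) x x) = 0 := by
  have e := hβ.jacobi_odd x hx hx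
  rw [hβ.skew_even x (bracket_odd_odd hx hx)] at e
  have : (3 : k) • β x (bracket (k := k) x x) = 0 := by
    rw [← sub_eq_zero.2 e]
    module
  exact (smul_eq_zero.1 this).resolve_left h3

theorem IsCocycle.odd_square_left (hx : x ∈ part (k := k) 1) (hy : y ∈ part (k := k) 1) :
    β y (bracket (k := k) x x) = -((2 : k) • β x (bracket (k := k) x y)) := by
  have e := hβ.jacobi_odd x hy hx
  have s := hβ.skew_even x (bracket_odd_odd hy hx)
  rw [e, s, (isCocycle_bracket (k := k)).skew_odd hy hx, two_smul]
  abel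

end OddOdd

theorem linearIndependent_triple {V : Type*} [AddCommGroup V] [Module k V] {u v w : V}
    (h : ∀ r s t : k, r • u + s • v + t • w = 0 → r = 0 ∧ s = 0 ∧ t = 0) :
    LinearIndependent k ![u, v, w] := by
  rw [Fintype.linearIndependent_iff]
  intro g hg
  rw [Fin.sum_univ_three] at hg
  obtain ⟨h0, h1, h2⟩ := h _ _ _ hg
  intro i
  fin_cases i
  exacts [h0, h1, h2]

/-- Two linearly independent vectors among `a`, `b`, `c` give three linearly independent vectors
among the syzygies `(a, 0)`, `(2b, a)`, `(c, 2b)`, `(0, c)`. -/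
theorem exists_three_syzygies {V : Type*} [AddCommGroup V] [Module k V] (h2 : (2 : k) ≠ 0)
    {a b c : V}
    (h : LinearIndependent k ![a, b] ∨ LinearIndependent k ![c, b] ∨
      LinearIndependent k ![a, c]) :
    ∃ v : Fin 3 → V × V, LinearIndependent k v ∧
      ∀ i, v i ∈ ({(a, 0), ((2 : k) • b, a), (c, (2 : k) • b), (0, c)} : Set (V × V)) := by
  rcases h with h | h | h <;> rw [LinearIndependent.pair_iff] at h
  · refine ⟨![(a, 0), ((2 : k) • b, a), (c, (2 : k) • b)],
      linearIndependent_triple fun r s t hrst => ?_, fun i => by fin_cases i <;> simp⟩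
    simp only [Prod.smul_mk, Prod.mk_add_mk, Prod.mk_eq_zero] at hrst
    obtain ⟨e1, e2⟩ := hrst
    obtain ⟨rfl, ht⟩ := h s (t * 2) (by rw [← e2]; module)
    obtain rfl : t = 0 := (mul_eq_zero.1 ht).resolve_right h2
    exact ⟨(h r 0 (by rw [← e1]; module)).1, rfl, rfl⟩
  · refine ⟨![((2 : k) • b, a), (c, (2 : k) • b), (0, c)],
      linearIndependent_triple fun r s t hrst => ?_, fun i => by fin_cases i <;> simp⟩
    simp only [Prod.smul_mk, Prod.mk_add_mk, Prod.mk_eq_zero] at hrst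
    obtain ⟨e1, e2⟩ := hrst
    obtain ⟨rfl, hr⟩ := h s (r * 2) (by rw [← e1]; module)
    obtain rfl : r = 0 := (mul_eq_zero.1 hr).resolve_right h2
    exact ⟨rfl, rfl, (h t 0 (by rw [← e2]; module)).1⟩
  · refine ⟨![(a, 0), ((2 : k) • b, a), (0, c)],
      linearIndependent_triple fun r s t hrst => ?_, fun i => by fin_cases i <;> simp⟩
    simp only [Prod.smul_mk, Prod.mk_add_mk, Prod.mk_eq_zero] at hrst
    obtain ⟨e1, e2⟩ := hrst
    obtain ⟨rfl, rfl⟩ := h s t (by rw [← e2]; module)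
    exact ⟨(h r 0 (by rw [← e1]; module)).1, rfl, rfl⟩

theorem exists_smul_of_not_linearIndependent {V : Type*} [AddCommGroup V] [Module k V] {u v : V}
    (hu : u ≠ 0) (h : ¬LinearIndependent k ![u, v]) : ∃ r : k, v = r • u := by
  rw [LinearIndependent.pair_iff' hu] at h
  push Not at h
  obtain ⟨r, hr⟩ := h
  exact ⟨r, hr.symm⟩

/-- The span of the three brackets of generators is stable under `x` and `y`, hence contains `L²`.
-/
theorem finrank_derived_le_three [FiniteDimensional k L] (hnil : IsNilpotent k L) {x y : L}
    {i j : ZMod 2} (hx : x ∈ part (k := k) i) (hy : y ∈ part (k := k) j)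
    (hxy : Submodule.span k {x, y} ⊔ derived k L = ⊤)
    (h : ∀ t ∈ ({x, y} : Set L), bracket (k := k) t (bracket (k := k) x x) = 0 ∧
      bracket (k := k) t (bracket (k := k) x y) = 0 ∧
      bracket (k := k) t (bracket (k := k) y y) = 0) :
    finrank k (derived k L) ≤ 3 := by
  refine (Submodule.finrank_mono (derived_le_of_stable hnil hx hy hxy
    (S := Submodule.span k {bracket (k := k) x x, bracket (k := k) x y, bracket (k := k) y y})
    (Submodule.subset_span (by simp)) (Submodule.subset_span (by simp))
    (Submodule.subset_span (by simp)) ?_ ?_)).trans (finrank_span_triple_le _ _ _)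
  all_goals
    rw [Submodule.span_le]
    rintro _ (rfl | rfl | rfl)
    all_goals rw [SetLike.mem_coe, Submodule.mem_comap]
  · simp [(h x (by simp)).1]
  · simp [(h x (by simp)).2.1]
  · simp [(h x (by simp)).2.2]
  · simp [(h y (by simp)).1]
  · simp [(h y (by simp)).2.1]
  · simp [(h y (by simp)).2.2]

/-- With `a = [x,x]`, `b = [x,y]`, `c = [y,y]`, the cube and square identities make `(a, 0)`, `(2b,
a)`, `(c, 2b)`, `(0, c)` syzygies. Three independent ones cancel the contribution of `β x x`, `β x
y`, `β y y`. -/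
theorem IsCocycle.finrank_map₂_le_of_odd_odd [FiniteDimensional k L] {β : L →ₗ[k] L →ₗ[k] E}
    (hβ : IsCocycle β) (h2 : (2 : k) ≠ 0) (h3 : (3 : k) ≠ 0) (hnil : IsNilpotent k L) {x y : L}
    (hx : x ∈ part (k := k) 1) (hy : y ∈ part (k := k) 1)
    (hxy : Submodule.span k {x, y} ⊔ derived k L = ⊤) (hd : 4 ≤ finrank k (derived k L)) :
    finrank k (Submodule.map₂ β ⊤ ⊤) ≤ 2 * finrank k (derived k L) := by
  have hB := isCocycle_bracket (k := k) (L := L)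
  set a := bracket (k := k) x x with ha
  set b := bracket (k := k) x y with hb
  set c := bracket (k := k) y y with hc
  have hsymm : bracket (k := k) y x = b := hB.skew_odd hy hx
  have cube_x := hB.odd_cube h3 hx
  have cube_y := hB.odd_cube h3 hy
  have sq_x := hB.odd_square_left hx hy
  have sq_y := hB.odd_square_left hy hx
  rw [hsymm] at sq_y
  rw [← ha] at cube_x sq_x
  rw [← hb] at sq_x
  rw [← hc] at cube_y sq_y
  -- If `a`, `b`, `c` were pairwise dependent, the same identities for the bracket would show that
  -- `x` and `y` kill all three, giving `d ≤ 3`.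
  have hind : LinearIndependent k ![a, b] ∨ LinearIndependent k ![c, b] ∨
      LinearIndependent k ![a, c] := by
    by_contra! hcon
    obtain ⟨hab, hcb, hac⟩ := hcon
    refine absurd (finrank_derived_le_three hnil hx hy hxy ?_) (by omega)
    rw [← ha, ← hb, ← hc]
    have hx0 : bracket (k := k) x a = 0 ∧ bracket (k := k) x b = 0 ∧ bracket (k := k) x c = 0 ∧
        bracket (k := k) y a = 0 ∧ bracket (k := k) y b = 0 ∧ bracket (k := k) y c = 0 := by
      by_cases ha0 : a = 0
      · have hxb : bracket (k := k) x b = 0 := by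
          rw [ha0, map_zero, eq_comm, neg_eq_zero] at sq_x
          exact (smul_eq_zero.1 sq_x).resolve_left h2
        by_cases hc0 : c = 0
        · have hyb : bracket (k := k) y b = 0 := by
            rw [hc0, map_zero, eq_comm, neg_eq_zero] at sq_y
            exact (smul_eq_zero.1 sq_y).resolve_left h2
          simp [ha0, hc0, hxb, hyb]
        · obtain ⟨r, hr⟩ := exists_smul_of_not_linearIndependent hc0 hcb
          have hyb : bracket (k := k) y b = 0 := by simp [hr, cube_y]
          simp [ha0, hxb, hyb, sq_y, cube_y]
      · obtain ⟨r, hr⟩ := exists_smul_of_not_linearIndependent ha0 hab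
        obtain ⟨s, hs⟩ := exists_smul_of_not_linearIndependent ha0 hac
        have hxb : bracket (k := k) x b = 0 := by simp [hr, cube_x]
        have hya : bracket (k := k) y a = 0 := by simp [sq_x, hxb]
        have hyb : bracket (k := k) y b = 0 := by simp [hr, hya]
        refine ⟨cube_x, hxb, ?_, hya, hyb, cube_y⟩
        simp [hs, cube_x]
    obtain ⟨h1, h2, h3, h4, h5, h6⟩ := hx0
    rintro _ (rfl | rfl)
    exacts [⟨h1, h2, h3⟩, ⟨h4, h5, h6⟩]
  obtain ⟨v, hv, hvmem⟩ := exists_three_syzygies h2 hind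
  have had : a ∈ derived k L := bracket_mem_derived x x
  have hbd : b ∈ derived k L := bracket_mem_derived x y
  have hcd : c ∈ derived k L := bracket_mem_derived y y
  have hmem : ∀ i, v i ∈ (derived k L).prod (derived k L) := by
    intro i
    rcases hvmem i with h | h | h | h <;> rw [h]
    exacts [⟨had, zero_mem _⟩, ⟨Submodule.smul_mem _ _ hbd, had⟩,
      ⟨hcd, Submodule.smul_mem _ _ hbd⟩, ⟨zero_mem _, hcd⟩]
  have hker : ∀ i, β x (v i).1 + β y (v i).2 = 0 := by
    intro i
    rcases hvmem i with h | h | h | h <;> rw [h]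
    · simp [ha, hβ.odd_cube h3 hx]
    · simp [ha, hβ.odd_square_left hx hy, hb]
    · simp [hc, hβ.odd_square_left hy hx, hsymm]
    · simp [hc, hβ.odd_cube h3 hy]
  have := hβ.finrank_map₂_add_le hnil hx hy hxy hv hmem hker
  have := finrank_span_triple_le (k := k) (β x x) (β x y) (β y y)
  omega

/-- Otherwise every bracket of an odd with an even element vanishes, so `x` and `y` kill the even
elements `[x,x]`, `[x,y]`, `[y,y]` and `d ≤ 3`. -/
theorem derived_inf_odd_ne_bot_of_odd_odd [FiniteDimensional k L] (hnil : IsNilpotent k L)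
    {x y : L} (hx : x ∈ part (k := k) 1) (hy : y ∈ part (k := k) 1)
    (hxy : Submodule.span k {x, y} ⊔ derived k L = ⊤) (hd : 4 ≤ finrank k (derived k L)) :
    derived k L ⊓ part (k := k) 1 ≠ ⊥ := by
  intro h0
  have key : ∀ t s : L, t ∈ part (k := k) 1 → s ∈ part (k := k) 0 →
      bracket (k := k) t s = 0 := fun t s ht hs => by
    rw [← Submodule.mem_bot k, ← h0]
    exact ⟨bracket_mem_derived t s, bracket_odd_even ht hs⟩
  refine absurd (finrank_derived_le_three hnil hx hy hxy ?_) (by omega)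
  have hxx := bracket_odd_odd hx hx
  have hxy := bracket_odd_odd hx hy
  have hyy := bracket_odd_odd hy hy
  rintro _ (rfl | rfl)
  exacts [⟨key _ _ hx hxx, key _ _ hx hxy, key _ _ hx hyy⟩,
    ⟨key _ _ hy hxx, key _ _ hy hxy, key _ _ hy hyy⟩]

/-! ### One even and one odd generator -/

/-- Source of the syzygy `([y,y], -2[x,y])`. -/
theorem IsCocycle.even_odd_square {β : L →ₗ[k] L →ₗ[k] E} (hβ : IsCocycle β) {x y : L}
    (hx : x ∈ part (k := k) 0) (hy : y ∈ part (k := k) 1) :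
    β x (bracket (k := k) y y) = (2 : k) • β y (bracket (k := k) x y) := by
  rw [hβ.jacobi_even y y hx, hβ.skew_odd (bracket_even_odd hx hy) hy, two_smul]

theorem derived_le_span_of_stable (hnil : IsNilpotent k L)
    {x y : L} {i j : ZMod 2} (hx : x ∈ part (k := k) i) (hy : y ∈ part (k := k) j)
    (hxy : Submodule.span k {x, y} ⊔ derived k L = ⊤) {T : Set L}
    (hxx : bracket (k := k) x x ∈ Submodule.span k T)
    (hxy' : bracket (k := k) x y ∈ Submodule.span k T)
    (hyy : bracket (k := k) y y ∈ Submodule.span k T)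
    (h : ∀ t ∈ T, bracket (k := k) x t ∈ Submodule.span k T ∧
      bracket (k := k) y t ∈ Submodule.span k T) :
    derived k L ≤ Submodule.span k T :=
  derived_le_of_stable hnil hx hy hxy hxx hxy' hyy
    (Submodule.span_le.2 fun t ht => (h t ht).1) (Submodule.span_le.2 fun t ht => (h t ht).2)

section EvenOdd

variable [FiniteDimensional k L] (h2 : (2 : k) ≠ 0) (h3 : (3 : k) ≠ 0) (hnil : IsNilpotent k L)
  {x y : L} (hx : x ∈ part (k := k) 0) (hy : y ∈ part (k := k) 1)
  (hxy : Submodule.span k {x, y} ⊔ derived k L = ⊤) (hd : 4 ≤ finrank k (derived k L))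
include h2 h3 hnil hx hy hxy hd

-- If `[x,y] = 0`, then `x` and `y` both kill `[y,y]`, which then spans `L²`.
omit [FiniteDimensional k L] in
theorem bracket_ne_zero_of_even_odd : bracket (k := k) x y ≠ 0 := by
  intro hb
  have hB := isCocycle_bracket (k := k) (L := L)
  have hxc := hB.even_odd_square hx hy
  rw [hb, map_zero, smul_zero] at hxc
  have hle := derived_le_span_of_stable hnil hx hy hxy (T := {bracket (k := k) y y})
    (by simp [hB.self_even h2 hx]) (by simp [hb]) (Submodule.mem_span_singleton_self _) (by
      rintro _ rfl
      simp [hxc, hB.odd_cube h3 hy])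
  have h1 := Submodule.finrank_mono hle
  have h2 := finrank_span_pair_le (k := k) (bracket (k := k) y y) (bracket (k := k) y y)
  rw [Set.pair_eq_singleton] at h2
  omega

/-- If the odd part of `L²` is a line, it is spanned by `b = [x, y]`, then `[x, b] = 0` and
`[y, y]`, `[b, b]` are independent, as `L²` is spanned by `b`, `[y, y]`, `[y, b]`, `[b, b]`. -/
theorem even_odd_independent_of_finrank_one
    (hodd : finrank k ↥(derived k L ⊓ part (k := k) 1) = 1) :
    bracket (k := k) x (bracket (k := k) x y) = 0 ∧
      LinearIndependent k ![bracket (k := k) y y,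
        bracket (k := k) (bracket (k := k) x y) (bracket (k := k) x y)] := by
  have hB := isCocycle_bracket (k := k) (L := L)
  have hxx := hB.self_even h2 hx
  have hxc := hB.even_odd_square hx hy
  have hyc := hB.odd_cube h3 hy
  have hb0 := bracket_ne_zero_of_even_odd h2 h3 hnil hx hy hxy hd
  have hbo := bracket_even_odd hx hy
  have hbd := bracket_mem_derived (k := k) x y
  set b := bracket (k := k) x y with hb
  have hspan : Submodule.span k {b} = derived k L ⊓ part (k := k) 1 := by
    refine Submodule.eq_of_le_of_finrank_eq ?_ (by rw [hodd, finrank_span_singleton hb0])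
    rw [Submodule.span_singleton_le_iff_mem]
    exact ⟨hbd, hbo⟩
  -- An odd bracket lies on the line through `b`; if it also equals `[t, b]`, nilpotency makes it
  -- zero.
  have key : ∀ p q t : L, bracket (k := k) p q ∈ part (k := k) 1 →
      bracket (k := k) p q = bracket (k := k) t b → bracket (k := k) p q = 0 := by
    intro p q t h ht
    rw [ht]
    refine bracket_eq_zero_of_mem_span hnil ?_
    rw [hspan, ← ht]
    exact ⟨bracket_mem_derived p q, h⟩
  have hxb : bracket (k := k) x b = 0 := key _ _ x (bracket_even_odd hx hbo) rfl
  have hce := bracket_odd_odd hy hy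
  set c := bracket (k := k) y y with hc
  have hue := bracket_odd_odd hy hbo
  have hyu : bracket (k := k) y (bracket (k := k) y b) = 0 := by
    refine key _ _ ((2 : k)⁻¹ • c) (bracket_odd_even hy hue) ?_
    have e := hB.jacobi_odd b hy hy
    rw [map_smul, LinearMap.smul_apply, eq_inv_smul_iff₀ h2, two_smul]
    nth_rw 1 [e]
    rw [← hc]
    abel
  set u := bracket (k := k) y b with hu
  have hxu : bracket (k := k) x u = bracket (k := k) b b := by
    rw [hu, hB.jacobi_even y b hx, hxb, map_zero, add_zero]
  have hve := bracket_odd_odd hbo hbo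
  set v := bracket (k := k) b b with hv
  have hxv : bracket (k := k) x v = 0 := by
    rw [hv, hB.jacobi_even b b hx, hxb]
    simp
  have hyv : bracket (k := k) y v = 0 := by
    refine key _ _ ((2 : k) • u) (bracket_odd_even hy hve) ?_
    rw [hv, hB.jacobi_odd b hy hbo, ← hu, ← neg_eq_iff_eq_neg.2 (hB.skew_even b hue), two_smul,
      map_add, LinearMap.add_apply]
    simp
  refine ⟨hxb, ?_⟩
  have hle := derived_le_span_of_stable hnil hx hy hxy (T := {b, c, u, v})
    (by simp [hxx]) (Submodule.subset_span (by simp [← hb]))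
    (Submodule.subset_span (by simp [← hc])) (by
      rintro _ (rfl | rfl | rfl | rfl)
      · rw [hxb]; exact ⟨zero_mem _, Submodule.subset_span (by simp [hu])⟩
      · rw [hxc, hyc]
        exact ⟨Submodule.smul_mem _ _ (Submodule.subset_span (by simp)), zero_mem _⟩
      · rw [hxu, hyu]; exact ⟨Submodule.subset_span (by simp), zero_mem _⟩
      · rw [hxv, hyv]; exact ⟨zero_mem _, zero_mem _⟩)
  have hrange : Set.range ![b, c, u, v] = {b, c, u, v} := by
    ext t
    simp
    tauto
  -- Four vectors whose span contains `L²`, of dimension at least 4, are independent; `c` and `v`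
  -- are extracted below.
  have hli : LinearIndependent k ![b, c, u, v] := by
    rw [linearIndependent_iff_card_le_finrank_span, Set.finrank, hrange, Fintype.card_fin]
    exact hd.trans (Submodule.finrank_mono hle)
  have := hli.comp ![1, 3] (by decide)
  convert this using 1
  ext i
  fin_cases i <;> rfl

/-- If `[y,y] = 0`, then `[y,b] = 0` for `b = [x,y]`. With `w = [x,b]`, the span of `b`, `w`,
`[b,b]` turns out to be stable under `x` and `y`, contradicting `d ≥ 4`. -/
theorem square_ne_zero_of_even_odd
    (hodd : finrank k ↥(derived k L ⊓ part (k := k) 1) = 2) : bracket (k := k) y y ≠ 0 := by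
  intro hc
  have hB := isCocycle_bracket (k := k) (L := L)
  have hxx := hB.self_even h2 hx
  have hxc := hB.even_odd_square hx hy
  have hb0 := bracket_ne_zero_of_even_odd h2 h3 hnil hx hy hxy hd
  have hbo := bracket_even_odd hx hy
  have hbd := bracket_mem_derived (k := k) x y
  set b := bracket (k := k) x y with hb
  have hyb : bracket (k := k) y b = 0 := by
    rw [hc, map_zero, eq_comm] at hxc
    exact (smul_eq_zero.1 hxc).resolve_left h2
  have hwo := bracket_even_odd hx hbo
  have hwd := bracket_mem_derived (k := k) x b
  set w := bracket (k := k) x b with hw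
  have hbw : bracket (k := k) b b + bracket (k := k) y w = 0 := by
    rw [← hB.jacobi_even y b hx, hyb, map_zero]
  have hli : LinearIndependent k ![b, w] := by
    by_contra hcon
    obtain ⟨r, hr⟩ := exists_smul_of_not_linearIndependent hb0 hcon
    have hw0 : w = 0 := bracket_eq_zero_of_mem_span hnil
      (Submodule.mem_span_singleton.2 ⟨r, hr.symm⟩)
    have hle := derived_le_span_of_stable hnil hx hy hxy (T := {b})
      (by simp [hxx]) (Submodule.subset_span (by simp [← hb])) (by simp [hc]) (by
        rintro _ rfl
        simp [← hw, hw0, hyb])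
    have h1 := Submodule.finrank_mono hle
    have h2 := finrank_span_pair_le (k := k) b b
    rw [Set.pair_eq_singleton] at h2
    omega
  have hrange : Set.range ![b, w] = {b, w} := by
    simp [Matrix.range_cons, Matrix.range_empty, Set.pair_comm]
  have hspan : Submodule.span k {b, w} = derived k L ⊓ part (k := k) 1 := by
    refine Submodule.eq_of_le_of_finrank_eq ?_ ?_
    · rw [Submodule.span_le]
      rintro _ (rfl | rfl)
      exacts [⟨hbd, hbo⟩, ⟨hwd, hwo⟩]
    · rw [hodd, ← hrange, finrank_span_eq_card hli, Fintype.card_fin]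
  -- Write `[x,w] = r b + s w`. If `r ≠ 0`, then `[x, ·]` maps the plane of `b` and `w` onto itself,
  -- against nilpotency; if `r = 0`, `w` is an eigenvector.
  have hxw : bracket (k := k) x w = 0 := by
    have hmem : bracket (k := k) x w ∈ Submodule.span k {b, w} := by
      rw [hspan]
      exact ⟨bracket_mem_derived x w, bracket_even_odd hx hwo⟩
    obtain ⟨r, s, hrs⟩ := Submodule.mem_span_pair.1 hmem
    by_cases hr : r = 0
    · refine bracket_eq_zero_of_mem_span hnil (Submodule.mem_span_singleton.2 ⟨s, ?_⟩)
      rw [← hrs, hr, zero_smul, zero_add]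
    · exfalso
      have hbot : Submodule.span k {b, w} = ⊥ := by
        refine eq_bot_of_le_commutator hnil (Submodule.span_le.2 ?_)
        have hcom : ∀ t ∈ Submodule.span k {b, w}, bracket (k := k) x t ∈
            commutator ⊤ (Submodule.span k {b, w}) := fun t ht =>
          Submodule.apply_mem_map₂ _ trivial ht
        have hbm : b ∈ Submodule.span k {b, w} := Submodule.subset_span (by simp)
        have hwm : w ∈ Submodule.span k {b, w} := Submodule.subset_span (by simp)
        rintro _ (rfl | rfl)
        · have e : b = bracket (k := k) x (r⁻¹ • (w - s • b)) := by
            rw [map_smul, map_sub, map_smul, ← hrs, ← hw, add_sub_cancel_right, smul_smul,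
              inv_mul_cancel₀ hr, one_smul]
          have h := hcom (r⁻¹ • (w - s • b)) (Submodule.smul_mem _ _
            (Submodule.sub_mem _ hwm (Submodule.smul_mem _ _ hbm)))
          rwa [← e] at h
        · exact hcom b hbm
      rw [Submodule.span_eq_bot] at hbot
      exact hb0 (hbot b (by simp))
  -- Applying `[x, ·]` to `[b,b] + [y,w] = 0` gives `3[b,w] = 0`, while `[x,[b,b]] = 2[b,w]`.
  have hxv : bracket (k := k) x (bracket (k := k) b b) = 0 := by
    have e1 := hB.jacobi_even b b hx
    have e2 := hB.jacobi_even y w hx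
    rw [← hw, hB.skew_odd hwo hbo] at e1
    rw [hxw, map_zero, add_zero, ← hb] at e2
    have e3 := congrArg (bracket (k := k) x) hbw
    rw [map_add, map_zero, e1, e2] at e3
    have e4 : (3 : k) • bracket (k := k) b w = 0 := by
      rw [← e3]
      module
    rw [e1, (smul_eq_zero.1 e4).resolve_left h3, add_zero]
  have hyv : bracket (k := k) y (bracket (k := k) b b) = 0 := by
    rw [hB.jacobi_odd b hy hbo, hyb]
    simp
  have hyw := eq_neg_of_add_eq_zero_right hbw
  have hle := derived_le_span_of_stable hnil hx hy hxy (T := {b, w, bracket (k := k) b b})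
    (by simp [hxx]) (Submodule.subset_span (by simp [← hb])) (by simp [hc]) (by
      rintro _ (rfl | rfl | rfl)
      · rw [hyb]; exact ⟨Submodule.subset_span (by simp [hw]), zero_mem _⟩
      · rw [hxw, hyw]
        exact ⟨zero_mem _, Submodule.neg_mem _ (Submodule.subset_span (by simp))⟩
      · rw [hxv, hyv]; exact ⟨zero_mem _, zero_mem _⟩)
  have h1 := Submodule.finrank_mono hle
  have h2 := finrank_span_triple_le (k := k) b w (bracket (k := k) b b)
  omega

/-- Since `β x x = 0`, the starting bound is `2 + 2d`. An odd part of `L²` of dimension `o` leaves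
`4 - o` syzygies to find, taken in order from `(c, -2b)`, `(0, c)`, `([b,b], 0)`; the last needs
`[x,b] = 0`, available when `o = 1`. -/
theorem IsCocycle.finrank_map₂_le_of_even_odd {β : L →ₗ[k] L →ₗ[k] E} (hβ : IsCocycle β) :
    finrank k (Submodule.map₂ β ⊤ ⊤) + 2 ≤
      2 * finrank k (derived k L) + finrank k ↥(derived k L ⊓ part (k := k) 1) := by
  have hb0 := bracket_ne_zero_of_even_odd h2 h3 hnil hx hy hxy hd
  have hbo := bracket_even_odd hx hy
  have hbd := bracket_mem_derived (k := k) x y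
  have hcd := bracket_mem_derived (k := k) y y
  have hcy := hβ.odd_cube h3 hy
  have hxc := hβ.even_odd_square hx hy
  have hG : finrank k (Submodule.span k {β x x, β x y, β y y}) ≤ 2 := by
    rw [hβ.self_even h2 hx, Submodule.span_insert_zero]
    exact finrank_span_pair_le _ _
  have main : ∀ {r : ℕ} {v : Fin r → L × L}, LinearIndependent k v →
      (∀ i, v i ∈ (derived k L).prod (derived k L)) →
      (∀ i, β x (v i).1 + β y (v i).2 = 0) →
      finrank k (Submodule.map₂ β ⊤ ⊤) + r ≤ 2 + 2 * finrank k (derived k L) :=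
    fun hv hmem hker => (hβ.finrank_map₂_add_le hnil hx hy hxy hv hmem hker).trans (by omega)
  have hodd : 0 < finrank k ↥(derived k L ⊓ part (k := k) 1) := by
    rw [Nat.pos_iff_ne_zero, Ne, Submodule.finrank_eq_zero]
    intro h
    exact hb0 ((Submodule.mem_bot k).1 (h ▸ ⟨hbd, hbo⟩))
  set b := bracket (k := k) x y with hb
  set c := bracket (k := k) y y with hc
  have hP : (c, -((2 : k) • b)) ∈ (derived k L).prod (derived k L) :=
    ⟨hcd, Submodule.neg_mem _ (Submodule.smul_mem _ _ hbd)⟩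
  have hQ : ((0 : L), c) ∈ (derived k L).prod (derived k L) := ⟨zero_mem _, hcd⟩
  have kP : β x (c, -((2 : k) • b)).1 + β y (c, -((2 : k) • b)).2 = 0 := by
    simp [hxc]
  have kQ : β x ((0 : L), c).1 + β y ((0 : L), c).2 = 0 := by simp [hcy]
  obtain h | h | h | h : finrank k ↥(derived k L ⊓ part (k := k) 1) = 1 ∨
      finrank k ↥(derived k L ⊓ part (k := k) 1) = 2 ∨
      finrank k ↥(derived k L ⊓ part (k := k) 1) = 3 ∨
      4 ≤ finrank k ↥(derived k L ⊓ part (k := k) 1) := by omega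
  · obtain ⟨hxb, hli⟩ := even_odd_independent_of_finrank_one h2 h3 hnil hx hy hxy hd h
    rw [← hb] at hxb hli
    rw [← hc, LinearIndependent.pair_iff] at hli
    have hv : LinearIndependent k
        ![(c, -((2 : k) • b)), ((0 : L), c), (bracket (k := k) b b, (0 : L))] := by
      refine linearIndependent_triple fun r s t hrst => ?_
      simp only [Prod.smul_mk, Prod.mk_add_mk, Prod.mk_eq_zero] at hrst
      obtain ⟨e1, e2⟩ := hrst
      obtain ⟨rfl, rfl⟩ := hli r t (by rw [← e1]; module)
      exact ⟨rfl, (hli s 0 (by rw [← e2]; module)).1, rfl⟩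
    have := main hv
      (by
        intro i
        fin_cases i
        exacts [hP, hQ, ⟨bracket_mem_derived b b, zero_mem _⟩])
      (by
        intro i
        fin_cases i
        · exact kP
        · exact kQ
        · simp [hβ.jacobi_even b b hx, hxb])
    omega
  · have hc0 := square_ne_zero_of_even_odd h2 h3 hnil hx hy hxy hd h
    have hv : LinearIndependent k ![(c, -((2 : k) • b)), ((0 : L), c)] := by
      rw [LinearIndependent.pair_iff]
      intro r s hrs
      simp only [Prod.smul_mk, Prod.mk_add_mk, Prod.mk_eq_zero, smul_zero, add_zero] at hrs
      obtain ⟨e1, e2⟩ := hrs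
      obtain rfl := (smul_eq_zero.1 e1).resolve_right hc0
      rw [zero_smul, zero_add] at e2
      exact ⟨rfl, (smul_eq_zero.1 e2).resolve_right hc0⟩
    have := main hv
      (by
        intro i
        fin_cases i
        exacts [hP, hQ])
      (by
        intro i
        fin_cases i
        exacts [kP, kQ])
    omega
  · have hv : LinearIndependent k ![(c, -((2 : k) • b))] := by
      rw [linearIndependent_unique_iff]
      intro h0
      have := (Prod.mk_eq_zero.1 h0).2
      rw [neg_eq_zero, smul_eq_zero] at this
      exact this.elim h2 hb0
    have := main hv
      (by
        intro i
        fin_cases i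
        exact hP)
      (by
        intro i
        fin_cases i
        exact kP)
    omega
  · have := main (r := 0) (v := ![]) linearIndependent_empty_type (fun i => i.elim0)
      (fun i => i.elim0)
    omega

end EvenOdd

/-! ### Homogeneous generators -/

/-- A nilpotent Lie superalgebra generated by even elements is even. -/
theorem part_zero_eq_top (hnil : IsNilpotent k L) (h : part (k := k) 0 ⊔ derived k L = ⊤) :
    part (k := k) (L := L) 0 = ⊤ := by
  have key : ∀ j, part (k := k) 0 ⊔ lowerCentral k L (j + 1) = ⊤ := fun j => by
    induction j with
    | zero => exact h
    | succ j ih =>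
      rw [eq_top_iff, ← h]
      refine sup_le le_sup_left (Submodule.map₂_le.2 fun p _ q _ => ?_)
      obtain ⟨p₀, hp₀, s, hs, rfl⟩ := Submodule.mem_sup.1 (ih ▸ Submodule.mem_top (x := p))
      obtain ⟨q₀, hq₀, t, ht, rfl⟩ := Submodule.mem_sup.1 (ih ▸ Submodule.mem_top (x := q))
      have e := neg_eq_iff_eq_neg.2 ((isCocycle_bracket (k := k)).skew_even s hq₀)
      -- The term `[s, q₀]` is flipped so that `s` stands in the second slot, the one in which the
      -- lower central series descends.
      have hexp : bracket (k := k) (p₀ + s) (q₀ + t) = bracket (k := k) p₀ q₀ +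
          (bracket (k := k) (p₀ + s) t - bracket (k := k) q₀ s) := by
        simp only [map_add, LinearMap.add_apply, ← e]
        abel
      rw [hexp]
      exact Submodule.add_mem_sup (bracket_even_even hp₀ hq₀)
        (Submodule.sub_mem _ (bracket_mem_lowerCentral_succ _ ht)
          (bracket_mem_lowerCentral_succ _ hs))
  obtain ⟨i, hi⟩ := hnil
  have := key i
  rwa [eq_bot_iff.2 ((lowerCentral_succ_le i).trans hi.le), sup_bot_eq] at this

theorem exists_relative_complement {V : Type*} [AddCommGroup V] [Module k V]
    [FiniteDimensional k V] {P Q : Submodule k V} (h : P ≤ Q) :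
    ∃ W : Submodule k V, W ≤ Q ∧ W ⊔ P = Q ∧ finrank k W + finrank k P = finrank k Q := by
  obtain ⟨C, hC⟩ := Submodule.exists_isCompl P
  have hsup : C ⊓ Q ⊔ P = Q := by
    rw [sup_comm, ← sup_inf_assoc_of_le C h, hC.sup_eq_top, top_inf_eq]
  refine ⟨C ⊓ Q, inf_le_right, hsup, ?_⟩
  have hinf : C ⊓ Q ⊓ P = ⊥ := by
    rw [eq_bot_iff, ← hC.inf_eq_bot]
    exact le_inf inf_le_right (inf_le_left.trans inf_le_left)
  have := Submodule.finrank_sup_add_finrank_inf_eq (C ⊓ Q) P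
  rw [hsup, hinf, finrank_bot, add_zero] at this
  exact this.symm

theorem exists_eq_span_pair {V : Type*} [AddCommGroup V] [Module k V] {W : Submodule k V}
    (h : finrank k W = 2) : ∃ x y, W = Submodule.span k {x, y} := by
  have : FiniteDimensional k W := FiniteDimensional.of_finrank_pos (by omega)
  let b := finBasisOfFinrankEq k W h
  refine ⟨b 0, b 1, ?_⟩
  have := congrArg (Submodule.map W.subtype) b.span_eq
  rw [Submodule.map_span, Submodule.map_subtype_top, ← Set.range_comp] at this
  refine this.symm.trans ?_
  congr 1
  ext t
  simp [Fin.exists_fin_two, eq_comm]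

theorem exists_eq_span_singleton {V : Type*} [AddCommGroup V] [Module k V] {W : Submodule k V}
    (h : finrank k W = 1) : ∃ x, W = Submodule.span k {x} := by
  have : FiniteDimensional k W := FiniteDimensional.of_finrank_pos (by omega)
  let b := finBasisOfFinrankEq k W h
  refine ⟨b 0, ?_⟩
  have := congrArg (Submodule.map W.subtype) b.span_eq
  rw [Submodule.map_span, Submodule.map_subtype_top, ← Set.range_comp] at this
  refine this.symm.trans ?_
  congr 1
  ext t
  simp [eq_comm]

theorem injective_mapQ_submoduleOf {V : Type*} [AddCommGroup V] [Module k V]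
    (K U : Submodule k V) :
    Function.Injective ((K.submoduleOf U).mapQ K U.subtype le_rfl) := by
  rw [← LinearMap.ker_eq_bot]
  refine Submodule.ker_liftQ_eq_bot _ _ _ ?_
  rw [LinearMap.ker_comp, Submodule.ker_mkQ]
  exact le_rfl

/-- Rank-nullity for the map induced by `f` on `D/K`, whose kernel contains `U/K`. Used with `K =
[R,F]`, `D = F²` and `U = R ∩ F²`, so that `U/K` is the multiplier. -/
theorem finrank_ker_inf_quotient_add_le {V W : Type*} [AddCommGroup V] [Module k V]
    [AddCommGroup W] [Module k W] (f : V →ₗ[k] W) (K : Submodule k V) (hK : K ≤ LinearMap.ker f)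
    (D U : Submodule k V) (hUf : U ≤ LinearMap.ker f) (hUD : U ≤ D)
    [FiniteDimensional k (D.map K.mkQ)] :
    FiniteDimensional k (U ⧸ K.submoduleOf U) ∧
      finrank k (U ⧸ K.submoduleOf U) + finrank k (D.map f) ≤ finrank k (D.map K.mkQ) := by
  let g : D.map K.mkQ →ₗ[k] W := (K.liftQ f hK).domRestrict _
  have hmem : ∀ q : U ⧸ K.submoduleOf U,
      (K.submoduleOf U).mapQ K U.subtype le_rfl q ∈ (LinearMap.ker g).map (Submodule.subtype _) := by
    intro q
    obtain ⟨u, rfl⟩ := Submodule.mkQ_surjective _ q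
    exact ⟨⟨K.mkQ u, u, hUD u.2, rfl⟩, hUf u.2, rfl⟩
  have hinj : Function.Injective
      (((K.submoduleOf U).mapQ K U.subtype le_rfl).codRestrict _ hmem) := by
    intro a b hab
    exact injective_mapQ_submoduleOf K U (congrArg Subtype.val hab)
  have hrange : D.map f ≤ LinearMap.range g := by
    rintro _ ⟨d, hd, rfl⟩
    exact ⟨⟨K.mkQ d, d, hd, rfl⟩, rfl⟩
  have h1 := LinearMap.finrank_le_finrank_of_injective hinj
  have h2 := g.finrank_range_add_finrank_ker
  have h3 := Submodule.finrank_mono hrange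
  rw [Submodule.finrank_map_subtype_eq] at h1
  exact ⟨FiniteDimensional.of_injective _ hinj, by omega⟩

/-! ### Dimension counts, choice of generators and the bound for cocycles -/

variable [FiniteDimensional k L]

theorem finrank_part_add :
    finrank k (part (k := k) (L := L) 0) + finrank k (part (k := k) (L := L) 1) = finrank k L :=
  Submodule.finrank_add_eq_of_isCompl isCompl

theorem finrank_derived_eq :
    finrank k ↥(derived k L ⊓ part (k := k) 0) + finrank k ↥(derived k L ⊓ part (k := k) 1) =
      finrank k (derived k L) := by
  have hsup : (derived k L ⊓ part (k := k) 0) ⊔ (derived k L ⊓ part (k := k) 1) = derived k L :=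
    le_antisymm (sup_le inf_le_left inf_le_left) derived_homogeneous
  have hinf : (derived k L ⊓ part (k := k) 0) ⊓ (derived k L ⊓ part (k := k) 1) = ⊥ := by
    rw [eq_bot_iff, ← (isCompl (k := k) (L := L)).inf_eq_bot]
    exact inf_le_inf inf_le_right inf_le_right
  have := Submodule.finrank_sup_add_finrank_inf_eq (derived k L ⊓ part (k := k) 0)
    (derived k L ⊓ part (k := k) 1)
  rw [hsup, hinf, finrank_bot, add_zero] at this
  exact this.symm

/-- A nilpotent Lie superalgebra with nonzero odd part and `dim L / L² = 2` has, modulo `L²`, either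
two odd generators or an even and an odd generator. -/
theorem exists_generators (hnil : IsNilpotent k L)
    (hodd : 1 ≤ finrank k (part (k := k) (L := L) 1))
    (hder : finrank k (derived k L) + 2 = finrank k L) :
    (∃ x ∈ part (k := k) (L := L) 1, ∃ y ∈ part (k := k) (L := L) 1,
      Submodule.span k {x, y} ⊔ derived k L = ⊤ ∧
      2 + finrank k ↥(derived k L ⊓ part (k := k) 1) = finrank k (part (k := k) (L := L) 1)) ∨
    (∃ x ∈ part (k := k) (L := L) 0, ∃ y ∈ part (k := k) (L := L) 1,
      Submodule.span k {x, y} ⊔ derived k L = ⊤ ∧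
      1 + finrank k ↥(derived k L ⊓ part (k := k) 1) = finrank k (part (k := k) (L := L) 1)) := by
  obtain ⟨V, hV, hVsup, hVdim⟩ := exists_relative_complement
    (inf_le_right : derived k L ⊓ part (k := k) 0 ≤ _)
  obtain ⟨W, hW, hWsup, hWdim⟩ := exists_relative_complement
    (inf_le_right : derived k L ⊓ part (k := k) 1 ≤ _)
  have h1 := finrank_part_add (k := k) (L := L)
  have h2 := finrank_derived_eq (k := k) (L := L)
  have htop : V ⊔ W ⊔ derived k L = ⊤ := by
    rw [eq_top_iff, ← (isCompl (k := k) (L := L)).sup_eq_top, ← hVsup, ← hWsup]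
    exact sup_le
      (sup_le (le_sup_left.trans le_sup_left) (inf_le_left.trans le_sup_right))
      (sup_le (le_sup_right.trans le_sup_left) (inf_le_left.trans le_sup_right))
  -- `V` and `W` are even and odd complements of `L²`, of total dimension `dim L/L² = 2`.
  obtain ⟨hv, hw⟩ | ⟨hv, hw⟩ | ⟨hv, hw⟩ : (finrank k V = 0 ∧ finrank k W = 2) ∨
      (finrank k V = 1 ∧ finrank k W = 1) ∨ (finrank k V = 2 ∧ finrank k W = 0) := by omega
  · obtain ⟨x, y, rfl⟩ := exists_eq_span_pair hw
    rw [Submodule.finrank_eq_zero.1 hv, bot_sup_eq] at htop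
    exact Or.inl ⟨x, hW (Submodule.subset_span (by simp)), y,
      hW (Submodule.subset_span (by simp)), htop, by rw [← hWdim, hw]⟩
  · obtain ⟨x, rfl⟩ := exists_eq_span_singleton hv
    obtain ⟨y, rfl⟩ := exists_eq_span_singleton hw
    rw [← Submodule.span_insert] at htop
    exact Or.inr ⟨x, hV (Submodule.mem_span_singleton_self x), y,
      hW (Submodule.mem_span_singleton_self y), htop, by rw [← hWdim, hw]⟩
  · exfalso
    rw [Submodule.finrank_eq_zero.1 hw, sup_bot_eq] at htop
    have hev := part_zero_eq_top hnil (eq_top_iff.2 (htop ▸ sup_le_sup_right hV _))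
    have := congrArg (fun U : Submodule k L => finrank k U) hev
    simp only [finrank_top] at this
    omega

theorem IsCocycle.finrank_map₂_le {β : L →ₗ[k] L →ₗ[k] E} (hβ : IsCocycle β) (h2 : (2 : k) ≠ 0)
    (h3 : (3 : k) ≠ 0) (hnil : IsNilpotent k L)
    (hodd : 1 ≤ finrank k (part (k := k) (L := L) 1))
    (hder : finrank k (derived k L) + 2 = finrank k L) (h6 : 6 ≤ finrank k L) :
    finrank k (Submodule.map₂ β ⊤ ⊤) + 3 ≤
      2 * finrank k (derived k L) + finrank k (part (k := k) (L := L) 1) := by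
  have hd : 4 ≤ finrank k (derived k L) := by omega
  obtain ⟨x, hx, y, hy, hxy, hdim⟩ | ⟨x, hx, y, hy, hxy, hdim⟩ :=
    exists_generators hnil hodd hder
  · have := hβ.finrank_map₂_le_of_odd_odd h2 h3 hnil hx hy hxy hd
    have hne := derived_inf_odd_ne_bot_of_odd_odd hnil hx hy hxy hd
    rw [Ne, ← Submodule.finrank_eq_zero (R := k)] at hne
    omega
  · have := hβ.finrank_map₂_le_of_even_odd h2 h3 hnil hx hy hxy hd
    omega

end LieSuperalgebra

/-! ### From a free presentation to a cocycle -/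

namespace FreePresentation

open LieSuperalgebra Module

variable {k L : Type*} [Field k] [AddCommGroup L] [Module k L] [LieSuperalgebra k L] {X : Type*}
  (P : FreePresentation k L X)

/-- The largest quotient `F / [R, F]` of the free presentation that is a central extension of `L`,
as a vector space. -/
abbrev CentralExtension : Type _ :=
  FreeLieSuperalgebra k P.parity ⧸ commutator P.relations ⊤

theorem exists_lift {a : ZMod 2} {x : L} (hx : x ∈ part (k := k) a) :
    ∃ u ∈ part (k := k) (L := FreeLieSuperalgebra k P.parity) a, P.toHom.toLinearMap u = x := by
  obtain ⟨u, rfl⟩ := P.surjective x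
  obtain ⟨u₀, h₀, u₁, h₁, rfl⟩ := exists_part_add (k := k) u
  have g₀ := P.toHom.map_part _ _ h₀
  have g₁ := P.toHom.map_part _ _ h₁
  rw [map_add] at hx ⊢
  rcases zmod_two_cases a with rfl | rfl
  · refine ⟨u₀, h₀, ?_⟩
    rw [eq_zero_of_mem_part ((Submodule.add_mem_iff_right _ g₀).1 hx) g₁, add_zero]
  · refine ⟨u₁, h₁, ?_⟩
    rw [eq_zero_of_mem_part g₀ ((Submodule.add_mem_iff_left _ g₁).1 hx), zero_add]

theorem relations_homogeneous {r : FreeLieSuperalgebra k P.parity} (hr : r ∈ P.relations) :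
    ∃ r₀ ∈ P.relations ⊓ part (k := k) 0, ∃ r₁ ∈ P.relations ⊓ part (k := k) 1, r₀ + r₁ = r := by
  obtain ⟨r₀, h₀, r₁, h₁, rfl⟩ := exists_part_add (k := k) r
  have g₀ := P.toHom.map_part _ _ h₀
  have g₁ := P.toHom.map_part _ _ h₁
  have h : P.toHom.toLinearMap r₀ + P.toHom.toLinearMap r₁ = 0 := by
    rw [← map_add]; exact hr
  have z₀ : P.toHom.toLinearMap r₀ = 0 := by
    refine eq_zero_of_mem_part g₀ ?_
    rw [eq_neg_of_add_eq_zero_left h]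
    exact Submodule.neg_mem _ g₁
  rw [z₀, zero_add] at h
  exact ⟨r₀, ⟨z₀, h₀⟩, r₁, ⟨h, h₁⟩, rfl⟩

theorem bracket_relations_mem {r : FreeLieSuperalgebra k P.parity} (hr : r ∈ P.relations)
    (u : FreeLieSuperalgebra k P.parity) :
    bracket (k := k) r u ∈ commutator P.relations ⊤ :=
  Submodule.apply_mem_map₂ _ hr trivial

/-- `[R,F]` is defined with `R` on the left; as `R` is homogeneous, graded skew-symmetry also allows
it on the right. -/
theorem bracket_mem_of_mem_relations (u : FreeLieSuperalgebra k P.parity)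
    {r : FreeLieSuperalgebra k P.parity} (hr : r ∈ P.relations) :
    bracket (k := k) u r ∈ commutator P.relations ⊤ := by
  obtain ⟨r₀, ⟨hr₀, h₀⟩, r₁, ⟨hr₁, h₁⟩, rfl⟩ := P.relations_homogeneous hr
  obtain ⟨u₀, g₀, u₁, g₁, rfl⟩ := exists_part_add (k := k) u
  have key : ∀ {a b : ZMod 2} {u r : FreeLieSuperalgebra k P.parity}, u ∈ part (k := k) a →
      r ∈ part (k := k) b → r ∈ P.relations →
      bracket (k := k) u r ∈ commutator P.relations ⊤ := fun hu hr hr' => by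
    rw [skew hu hr]
    exact Submodule.neg_mem _ (Submodule.smul_mem _ _ (P.bracket_relations_mem hr' _))
  simp only [map_add, LinearMap.add_apply]
  exact Submodule.add_mem _ (Submodule.add_mem _ (key g₀ h₀ hr₀) (key g₁ h₀ hr₀))
    (Submodule.add_mem _ (key g₀ h₁ hr₁) (key g₁ h₁ hr₁))

/-- The bracket of `F / [R, F]`, as a cocycle on `L`. -/
theorem exists_cocycle : ∃ β : L →ₗ[k] L →ₗ[k] P.CentralExtension, IsCocycle β ∧
    ∀ u v, β (P.toHom.toLinearMap u) (P.toHom.toLinearMap v) =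
      (commutator P.relations ⊤).mkQ (bracket (k := k) u v) := by
  obtain ⟨σ, hσ⟩ := P.toHom.toLinearMap.exists_rightInverse_of_surjective
    (LinearMap.range_eq_top.2 P.surjective)
  have hσ' : ∀ x, P.toHom.toLinearMap (σ x) = x := fun x => LinearMap.congr_fun hσ x
  let β : L →ₗ[k] L →ₗ[k] P.CentralExtension :=
    ((bracket (k := k)).compl₁₂ σ σ).compr₂ (commutator P.relations ⊤).mkQ
  -- The linear section `σ` need not respect parity. But modulo `[R,F]` the bracket does not depend
  -- on the lifts, so the identities can be checked on homogeneous ones.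
  have hβ : ∀ u v, β (P.toHom.toLinearMap u) (P.toHom.toLinearMap v) =
      (commutator P.relations ⊤).mkQ (bracket (k := k) u v) := by
    intro u v
    have hrel : ∀ w, σ (P.toHom.toLinearMap w) - w ∈ P.relations := fun w => by
      rw [relations, LinearMap.mem_ker, map_sub, hσ', sub_self]
    change (commutator P.relations ⊤).mkQ (bracket (k := k) _ _) = _
    rw [← sub_eq_zero, ← map_sub, Submodule.mkQ_apply, Submodule.Quotient.mk_eq_zero]
    have := Submodule.add_mem _
      (P.bracket_relations_mem (hrel u) (σ (P.toHom.toLinearMap v)))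
      (P.bracket_mem_of_mem_relations u (hrel v))
    rwa [map_sub, map_sub, LinearMap.sub_apply, sub_add_sub_cancel] at this
  refine ⟨β, ⟨?_, ?_⟩, hβ⟩
  · intro a b x y hx hy
    obtain ⟨u, hu, rfl⟩ := P.exists_lift hx
    obtain ⟨v, hv, rfl⟩ := P.exists_lift hy
    rw [hβ, hβ, ← map_smul, ← map_neg, ← skew hu hv]
  · intro a b x y z hx hy
    obtain ⟨u, hu, rfl⟩ := P.exists_lift hx
    obtain ⟨v, hv, rfl⟩ := P.exists_lift hy
    obtain ⟨w, rfl⟩ := P.surjective z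
    simp only [← P.toHom.map_bracket, hβ]
    rw [← map_smul, ← map_add, ← jacobi hu hv]

/-- The Schur multiplier is finite-dimensional, and a cocycle `β` on `L` bounds its dimension. -/
theorem exists_cocycle_finrank [FiniteDimensional k L] :
    FiniteDimensional k P.SchurMultiplier ∧
      ∃ β : L →ₗ[k] L →ₗ[k] P.CentralExtension, IsCocycle β ∧
        finrank k P.SchurMultiplier + finrank k (derived k L) ≤
          finrank k (Submodule.map₂ β ⊤ ⊤) := by
  obtain ⟨β, hβ, hβF⟩ := P.exists_cocycle
  have hmap : (derived k (FreeLieSuperalgebra k P.parity)).map (commutator P.relations ⊤).mkQ ≤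
      Submodule.map₂ β ⊤ ⊤ := by
    refine Submodule.map_le_iff_le_comap.2 (Submodule.map₂_le.2 fun u _ v _ => ?_)
    rw [Submodule.mem_comap, ← hβF]
    exact Submodule.apply_mem_map₂ _ trivial trivial
  have hfin : FiniteDimensional k (Submodule.map₂ β ⊤ ⊤) :=
    Module.Finite.iff_fg.2 (Submodule.FG.map₂ β Module.Finite.fg_top Module.Finite.fg_top)
  have hfin' : FiniteDimensional k
      ((derived k (FreeLieSuperalgebra k P.parity)).map (commutator P.relations ⊤).mkQ) :=
    Submodule.finiteDimensional_of_le hmap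
  have hker : commutator P.relations ⊤ ≤ LinearMap.ker P.toHom.toLinearMap :=
    Submodule.map₂_le.2 fun r hr u _ => by
      rw [LinearMap.mem_ker, P.toHom.map_bracket, LinearMap.mem_ker.1 hr]
      simp
  have hder : derived k L ≤
      (derived k (FreeLieSuperalgebra k P.parity)).map P.toHom.toLinearMap := by
    refine Submodule.map₂_le.2 fun a _ b _ => ?_
    obtain ⟨u, rfl⟩ := P.surjective a
    obtain ⟨v, rfl⟩ := P.surjective b
    exact ⟨bracket (k := k) u v, bracket_mem_derived u v, P.toHom.map_bracket u v⟩
  obtain ⟨h1, h2⟩ := finrank_ker_inf_quotient_add_le P.toHom.toLinearMap _ hker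
    (derived k (FreeLieSuperalgebra k P.parity)) _ inf_le_left inf_le_right
  refine ⟨h1, β, hβ, ?_⟩
  exact (Nat.add_le_add_left (Submodule.finrank_mono hder) _).trans
    (h2.trans (Submodule.finrank_mono hmap))

end FreePresentation

end

theorem theorem2p5 {k L : Type*} [Field k] [AddCommGroup L] [Module k L] [LieSuperalgebra k L]
    [FiniteDimensional k L] (h2 : (2 : k) ≠ 0) (h3 : (3 : k) ≠ 0) (m n : ℕ)
    (hm : Module.finrank k (LieSuperalgebra.part (k := k) (L := L) 0) = m)
    (hn : Module.finrank k (LieSuperalgebra.part (k := k) (L := L) 1) = n)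
    (hn1 : 1 ≤ n)
    (hnil : LieSuperalgebra.IsNilpotent k L)
    (hder : (Module.finrank k (LieSuperalgebra.derived k L) : ℤ) = m + n - 2)
    {X : Type*} (P : FreePresentation k L X) :
    FiniteDimensional k P.SchurMultiplier ∧
      (6 ≤ m + n → (Module.finrank k P.SchurMultiplier : ℤ) < m + 2 * n - 4) ∧
      ((Module.finrank k P.SchurMultiplier : ℤ) = m + 2 * n - 4 → m + n ≤ 5) := by
  obtain ⟨hfin, β, hβ, hdim⟩ := P.exists_cocycle_finrank
  have hsum := LieSuperalgebra.finrank_part_add (k := k) (L := L)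
  have main : 6 ≤ m + n → (Module.finrank k P.SchurMultiplier : ℤ) < m + 2 * n - 4 := by
    intro h6
    -- With `d = m + n - 2`, this gives `dim M(L) ≤ d + n - 3 = m + 2n - 5`.
    have := hβ.finrank_map₂_le h2 h3 hnil (by omega) (by omega) (by omega)
    omega
  exact ⟨hfin, main, fun h => by by_contra hlt; have := main (by omega); omega⟩
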